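/- Let $Q$ be a hyperbolic group, that is, a finitely generated group such that for some finite generating set the geodesic triangles of the Cayley graph are uniformly slim. Call a finitely generated subgroup $H \leqslant Q$ quasiconvex if there are a finite generating set of $Q$ and a constant $\sigma \geq 0$ such that every geodesic of the corresponding Cayley graph with endpoints in $H$ lies in the $\sigma$-neighbourhood of $H$. For subgroups $H_1, \dots, H_n \leqslant Q$ with $n \geq 1$ and $g \in H_1 \cdots H_n$, a product representative of $g$ is a tuple $(h_1, \dots, h_n) \in H_1 \times \dots \times H_n$ with $g = h_1 \cdots h_n$. Two product representatives $(h_1, \dots, h_n)$ and $(k_1, \dots, k_n)$ of $g$ are equivalent if there are elements $s_i \in H_i \cap H_{i+1}$ for $1 \leq i \leq n-1$ such that, with $s_0 = s_n = 1$, we have $s_{i-1} k_i = h_i s_i$ for all $i = 1, \dots, n$. Then $Q$ has bottlenecked product representatives over the class of its quasiconvex subgroups: for all $n \geq 1$, all quasiconvex subgroups $H_1, \dots, H_n$ of $Q$ and all $g \in H_1 \cdots H_n$, there are sets $R_1, \dots, R_n \subseteq H_1 \times \dots \times H_n$ of product representatives of $g$ such that the projection of $R_i$ to $H_i$ has finite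 image for each $i$, and every product representative of $g$ is equivalent to an element of $R_1 \cup \dots \cup R_n$. In terms of word length: for every finite generating set $S$ of $Q$, all $n \geq 1$ and all quasiconvex subgroups $H_1, \dots, H_n$ of $Q$ there is a function $f \colon \mathbb{N} \to \mathbb{N}$ such that for every $g \in H_1 \cdots H_n$, every product representative of $g$ is equivalent to a product representative $(k_1, \dots, k_n)$ of $g$ with $|k_i|_S \leq f(|g|_S)$ for some $i \in \{1, \dots, n\}$ (the index $i$ may depend on the product representative). -/

import Mathlib

namespace SimpleGraph

/-- A walk is geodesic if it realises the edge-path distance between its endpoints. -/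
def Walk.IsGeodesic {V : Type*} {Γ : SimpleGraph V} {x y : V} (p : Γ.Walk x y) : Prop :=
  p.length = Γ.dist x y

/-- Every geodesic triangle of the graph is `δ`-slim: each side lies in the `δ`-neighbourhood of
the union of the other two sides. The corners `x, y, z` and the sides are arbitrary, so it is
enough to speak about the side `p`. -/
def SlimTriangles {V : Type*} (Γ : SimpleGraph V) (δ : ℕ) : Prop :=
  ∀ (x y z : V) (p : Γ.Walk x y) (q : Γ.Walk y z) (r : Γ.Walk x z),
    p.IsGeodesic → q.IsGeodesic → r.IsGeodesic →
      ∀ v ∈ p.support, ∃ w, (w ∈ q.support ∨ w ∈ r.support) ∧ Γ.dist v w ≤ δ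

/-- The set `Y` of vertices is `σ`-quasiconvex: every geodesic with endpoints in `Y` lies in the
`σ`-neighbourhood of `Y`. -/
def Quasiconvex {V : Type*} (Γ : SimpleGraph V) (σ : ℕ) (Y : Set V) : Prop :=
  ∀ (x y : V) (p : Γ.Walk x y), x ∈ Y → y ∈ Y → p.IsGeodesic →
    ∀ v ∈ p.support, ∃ w ∈ Y, Γ.dist v w ≤ σ

end SimpleGraph

/-- `S` is a finite generating set of the group `G`. -/
def IsFiniteGeneratingSet {G : Type*} [Group G] (S : Set G) : Prop :=
  S.Finite ∧ Subgroup.closure S = ⊤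

/-- `|g| = d(1, g)`, the distance in the Cayley graph with respect to `S`. -/
noncomputable def wordLength {G : Type*} [Group G] (S : Set G) (g : G) : ℕ :=
  (SimpleGraph.mulCayley S).dist 1 g

/-- A group is hyperbolic if it is finitely generated and its Cayley graph with respect to some
finite generating set has uniformly slim geodesic triangles. -/
def IsHyperbolicGroup (G : Type*) [Group G] : Prop :=
  ∃ S : Set G, IsFiniteGeneratingSet S ∧ ∃ δ : ℕ, (SimpleGraph.mulCayley S).SlimTriangles δ

/-- A finitely generated subgroup is quasiconvex if, for some `σ`, it is a `σ`-quasiconvex subset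
of the Cayley graph of the group with respect to some finite generating set. -/
def IsQuasiconvexSubgroup {G : Type*} [Group G] (H : Subgroup G) : Prop :=
  H.FG ∧ ∃ S : Set G, IsFiniteGeneratingSet S ∧
    ∃ σ : ℕ, (SimpleGraph.mulCayley S).Quasiconvex σ (H : Set G)

/-- The tuple `h` is a product representative of `g` in `H₁ ⋯ Hₙ`: `hᵢ ∈ Hᵢ` and
`g = h₁ ⋯ hₙ`. (Such a tuple exists exactly when `g ∈ H₁ ⋯ Hₙ`.) -/
def IsProductRep {G : Type*} [Group G] {n : ℕ} (H : Fin n → Subgroup G) (g : G)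
    (h : Fin n → G) : Prop :=
  (∀ i, h i ∈ H i) ∧ (List.ofFn h).prod = g

/-- Equivalence of the tuples `h` and `k`: there are `s₀, …, sₙ` with `s₀ = sₙ = 1` and
`sᵢ ∈ Hᵢ ∩ Hᵢ₊₁` for `1 ≤ i < n`, such that `sᵢ₋₁ kᵢ = hᵢ sᵢ` for `1 ≤ i ≤ n`.
(The subgroup `Hᵢ` of this description is `H ⟨i - 1, _⟩` below.) -/
def ProductRepEquiv {G : Type*} [Group G] {n : ℕ} (H : Fin n → Subgroup G)
    (h k : Fin n → G) : Prop :=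
  ∃ s : Fin (n + 1) → G, s 0 = 1 ∧ s (Fin.last n) = 1 ∧
    (∀ (i : ℕ) (hi : i + 1 < n),
      s ⟨i + 1, by omega⟩ ∈ H ⟨i, by omega⟩ ⊓ H ⟨i + 1, hi⟩) ∧
    ∀ i : Fin n, s i.castSucc * k i = h i * s i.succ

/-- `G` has bottlenecked product representatives over the class `C` of subgroups: for
`H₁, …, Hₙ ∈ C` with `n ≥ 1` and for `g` there are sets `R₁, …, Rₙ` of product representatives
of `g` such that the projection of `Rᵢ` to the `i`-th factor is finite for each `i`, and every
product representative of `g` is equivalent to one in `R₁ ∪ ⋯ ∪ Rₙ`. -/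
def HasBottleneckedProductReps {G : Type*} [Group G] (C : Set (Subgroup G)) : Prop :=
  ∀ (n : ℕ), 0 < n → ∀ H : Fin n → Subgroup G, (∀ i, H i ∈ C) → ∀ g : G,
    ∃ R : Fin n → Set (Fin n → G),
      (∀ i, ∀ k ∈ R i, IsProductRep H g k) ∧
      (∀ i, ((fun k : Fin n → G => k i) '' R i).Finite) ∧
      ∀ h, IsProductRep H g h → ∃ i, ∃ k ∈ R i, ProductRepEquiv H h k

/-! Among the representatives equivalent to a given one, take `k` with the least total word length.
The partial products of `k` form a broken line from `1` to `g` whose sides have lengths `|kᵢ|`. If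
the Gromov product at a corner is large, the two sides fellow-travel; both stay near cosets of
quasiconvex subgroups, so a pigeonhole argument finds `s ∈ Hᵢ ∩ Hᵢ₊₁` whose transfer across the
corner shortens both factors (`exists_mem_inf_wordLength_lt`), against minimality. Hence all corners
are bounded, and if all sides were longer than `|g| + L`, the broken line would end at least `|k₁|`
away from its origin (`SlimTriangles.dist_le_of_broken_line`), giving `|k₁| ≤ |g|`, a contradiction.

Each subgroup may be quasiconvex for its own generating set; stability of quasi-geodesics moves them
all to one set with slim triangles. Finiteness of balls then gives the finite projections. -/

namespace SimpleGraph

/-! ### Geodesics and slim triangles -/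

variable {V : Type*} {Γ : SimpleGraph V}

/-- `x` lies on some geodesic from `a` to `b`. -/
def Between (Γ : SimpleGraph V) (a x b : V) : Prop :=
  Γ.dist a x + Γ.dist x b = Γ.dist a b

theorem Between.symm {a x b : V} (h : Γ.Between a x b) : Γ.Between b x a := by
  unfold Between at *
  rw [Γ.dist_comm (u := b) (v := x), Γ.dist_comm (u := x) (v := a),
    Γ.dist_comm (u := b) (v := a)]
  omega

theorem between_left (a b : V) : Γ.Between a a b := by simp [Between]

theorem between_right (a b : V) : Γ.Between a b b := by simp [Between]

theorem Walk.dist_getVert_getVert_le {a b : V} (p : Γ.Walk a b) {i j : ℕ} (hij : i ≤ j) :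
    Γ.dist (p.getVert i) (p.getVert j) ≤ j - i := by
  have h := (Γ.dist_le ((p.drop i).take (j - i))).trans_eq (Walk.take_length _ _)
  rw [Walk.drop_getVert, show i + (j - i) = j by omega] at h
  exact h.trans (min_le_left _ _)

theorem Connected.exists_geodesic_of_between (hΓ : Γ.Connected) {a x b : V}
    (h : Γ.Between a x b) : ∃ p : Γ.Walk a b, p.IsGeodesic ∧ x ∈ p.support := by
  obtain ⟨p, hp⟩ := hΓ.exists_walk_length_eq_dist a x
  obtain ⟨q, hq⟩ := hΓ.exists_walk_length_eq_dist x b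
  refine ⟨p.append q, ?_, ?_⟩
  · rw [Walk.IsGeodesic, Walk.length_append, hp, hq]
    exact h
  · rw [Walk.mem_support_append_iff]
    exact Or.inl p.end_mem_support

theorem Walk.IsGeodesic.between (hΓ : Γ.Connected) {a x b : V} {p : Γ.Walk a b}
    (hp : p.IsGeodesic) (hx : x ∈ p.support) : Γ.Between a x b := by
  obtain ⟨q, r, rfl⟩ := Walk.mem_support_iff_exists_append.1 hx
  rw [Walk.IsGeodesic, Walk.length_append] at hp
  have h₁ := Γ.dist_le q
  have h₂ := Γ.dist_le r
  have h₃ := hΓ.dist_triangle (u := a) (v := x) (w := b)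
  unfold Between
  omega

theorem Connected.exists_dist_eq (hΓ : Γ.Connected) {a b : V} {t : ℕ} (ht : t ≤ Γ.dist a b) :
    ∃ y, Γ.Between a y b ∧ Γ.dist a y = t := by
  obtain ⟨p, hp⟩ := hΓ.exists_walk_length_eq_dist a b
  have h₁ := p.dist_getVert_getVert_le (Nat.zero_le t)
  have h₂ := p.dist_getVert_getVert_le (show t ≤ p.length by omega)
  rw [Walk.getVert_zero] at h₁
  rw [Walk.getVert_length] at h₂
  have h₃ := hΓ.dist_triangle (u := a) (v := p.getVert t) (w := b)
  refine ⟨p.getVert t, ?_, ?_⟩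
  · unfold Between
    omega
  · omega

theorem SlimTriangles.exists_between {δ : ℕ} (hδ : Γ.SlimTriangles δ) (hΓ : Γ.Connected)
    {a x b : V} (h : Γ.Between a x b) (c : V) :
    ∃ w, (Γ.Between a w c ∨ Γ.Between c w b) ∧ Γ.dist x w ≤ δ := by
  obtain ⟨p, hp, hx⟩ := hΓ.exists_geodesic_of_between h
  obtain ⟨q, hq⟩ := hΓ.exists_walk_length_eq_dist b c
  obtain ⟨r, hr⟩ := hΓ.exists_walk_length_eq_dist a c
  obtain ⟨w, hw, hxw⟩ := hδ a b c p q r hp hq hr x hx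
  refine ⟨w, ?_, hxw⟩
  rcases hw with hw | hw
  · exact Or.inr (Walk.IsGeodesic.between hΓ hq hw).symm
  · exact Or.inl (Walk.IsGeodesic.between hΓ hr hw)

/-- The four-point inequality in a graph with slim triangles. -/
theorem SlimTriangles.four_point {δ : ℕ} (hδ : Γ.SlimTriangles δ) (hΓ : Γ.Connected)
    (x y z w : V) :
    Γ.dist x z + Γ.dist w y ≤ Γ.dist x y + Γ.dist w z + (4 * δ + 2) ∨
      Γ.dist x z + Γ.dist w y ≤ Γ.dist y z + Γ.dist w x + (4 * δ + 2) := by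
  -- Choose `p` closest to `x` among the points between `x` and `z` that are `δ`-close to `[y, z]`.
  -- Its predecessor must be `δ`-close to `[x, y]`, which costs one more unit.
  have key : ∃ p, Γ.Between x p z ∧ (∃ u, Γ.Between x u y ∧ Γ.dist p u ≤ δ + 1) ∧
      ∃ v, Γ.Between y v z ∧ Γ.dist p v ≤ δ + 1 := by
    classical
    have hex : ∃ t, ∃ p, Γ.Between x p z ∧ Γ.dist x p = t ∧
        ∃ v, Γ.Between y v z ∧ Γ.dist p v ≤ δ :=
      ⟨_, z, between_right _ _, rfl, z, between_right _ _, by simp⟩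
    obtain ⟨p, hp, hpt, v, hv, hpv⟩ := Nat.find_spec hex
    have hmin := fun m => Nat.find_min (H := hex) (m := m)
    rw [← hpt] at hmin
    refine ⟨p, hp, ?_, v, hv, by omega⟩
    rcases Nat.eq_zero_or_pos (Γ.dist x p) with h0 | h0
    · rw [hΓ.dist_eq_zero_iff] at h0
      subst h0
      exact ⟨x, between_left _ _, by simp⟩
    · obtain ⟨q, hq, hqt⟩ := hΓ.exists_dist_eq (a := x) (b := p) (t := Γ.dist x p - 1) (by omega)
      have hqz : Γ.Between x q z := by
        have h₁ := hΓ.dist_triangle (u := x) (v := q) (w := z)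
        have h₂ := hΓ.dist_triangle (u := q) (v := p) (w := z)
        unfold Between at *
        omega
      obtain ⟨u, hu, hqu⟩ := hδ.exists_between hΓ hqz y
      rcases hu with hu | hu
      · refine ⟨u, hu, ?_⟩
        have h₁ := hΓ.dist_triangle (u := p) (v := q) (w := u)
        rw [Γ.dist_comm (u := p) (v := q)] at h₁
        unfold Between at hq
        omega
      · exact absurd ⟨q, hqz, rfl, u, hu, hqu⟩ (hmin _ (by omega))
  obtain ⟨p, hp, ⟨u, hu, hpu⟩, v, hv, hpv⟩ := key
  -- Both distances on the left are estimated by detours through `p`, each using one hop of length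
  -- at most `δ` and one of length at most `δ + 1`; in total `4 * δ + 2`.
  obtain ⟨r, hr, hpr⟩ := hδ.exists_between hΓ hp w
  have c₁ := Γ.dist_comm (u := r) (v := p)
  have c₂ := Γ.dist_comm (u := w) (v := x)
  have c₃ := Γ.dist_comm (u := w) (v := r)
  rcases hr with hr | hr
  · right
    have h₁ := hΓ.dist_triangle (u := w) (v := r) (w := y)
    have h₂ := hΓ.dist_triangle (u := r) (v := p) (w := y)
    have h₃ := hΓ.dist_triangle (u := p) (v := v) (w := y)
    have h₄ := hΓ.dist_triangle (u := x) (v := r) (w := z)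
    have h₅ := hΓ.dist_triangle (u := r) (v := p) (w := z)
    have h₆ := hΓ.dist_triangle (u := p) (v := v) (w := z)
    have c₄ := Γ.dist_comm (u := y) (v := v)
    unfold Between at *
    omega
  · left
    have h₁ := hΓ.dist_triangle (u := w) (v := r) (w := y)
    have h₂ := hΓ.dist_triangle (u := r) (v := p) (w := y)
    have h₃ := hΓ.dist_triangle (u := p) (v := u) (w := y)
    have h₄ := hΓ.dist_triangle (u := x) (v := u) (w := z)
    have h₅ := hΓ.dist_triangle (u := u) (v := p) (w := z)
    have h₆ := hΓ.dist_triangle (u := p) (v := r) (w := z)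
    have c₄ := Γ.dist_comm (u := p) (v := u)
    unfold Between at *
    omega

/-- A broken line with long sides and small Gromov products at its corners does not come closer
to its origin than the end of its first side. -/
theorem SlimTriangles.dist_le_of_broken_line {δ : ℕ} (hδ : Γ.SlimTriangles δ) (hΓ : Γ.Connected)
    {C n : ℕ} {x : ℕ → V} (hn : 0 < n)
    (hside : ∀ i < n, 2 * C + (4 * δ + 2) < Γ.dist (x i) (x (i + 1)))
    (hcorner : ∀ i, i + 1 < n → Γ.dist (x i) (x (i + 1)) + Γ.dist (x (i + 1)) (x (i + 2)) ≤
      Γ.dist (x i) (x (i + 2)) + 2 * C) :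
    Γ.dist (x 0) (x 1) ≤ Γ.dist (x 0) (x n) := by
  -- The Gromov product of `x 0` and `x (i + 1)` at `x i` stays bounded by `C + 2 * δ + 1`. In the
  -- four-point inequality based at `x (i + 1)`, the first alternative would force `Γ.dist (x i) (x
  -- (i + 1)) ≤ 2 * C + (4 * δ + 2)`, which the length of the sides excludes.
  have key : ∀ i, i < n → Γ.dist (x 0) (x i) + Γ.dist (x i) (x (i + 1)) ≤
      Γ.dist (x 0) (x (i + 1)) + 2 * C + (4 * δ + 2) := by
    intro i
    induction i with
    | zero => intro _; simp; omega
    | succ i ih =>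
      intro hi
      have h₁ := ih (by omega)
      have h₂ := hcorner i hi
      have h₃ := hside i (by omega)
      have c₁ := Γ.dist_comm (u := x (i + 1)) (v := x i)
      have c₂ := Γ.dist_comm (u := x (i + 1)) (v := x 0)
      have c₃ := Γ.dist_comm (u := x (i + 2)) (v := x 0)
      have c₄ := Γ.dist_comm (u := x (i + 1)) (v := x (i + 2))
      rw [show i + 1 + 1 = i + 2 from rfl]
      rcases hδ.four_point hΓ (x i) (x 0) (x (i + 2)) (x (i + 1)) with h | h <;>
      · have c₅ := Γ.dist_comm (u := x i) (v := x 0)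
        omega
  have mono : ∀ i, i < n → Γ.dist (x 0) (x 1) ≤ Γ.dist (x 0) (x (i + 1)) := by
    intro i
    induction i with
    | zero => intro _; simp
    | succ i ih =>
      intro hi
      have h₁ := ih (by omega)
      have h₂ := key (i + 1) hi
      have h₃ := hside (i + 1) hi
      omega
  have h := mono (n - 1) (by omega)
  rwa [Nat.sub_add_cancel hn] at h

/-- A geodesic stays logarithmically close to any chain of points with the same endpoints. -/
theorem SlimTriangles.exists_dist_chain_le {δ : ℕ} (hδ : Γ.SlimTriangles δ) (hΓ : Γ.Connected)
    {c : ℕ → V} {K : ℕ} (k : ℕ) {a b : ℕ} (hab : a ≤ b) (hk : b - a ≤ 2 ^ k)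
    (hc : ∀ j, a ≤ j → j < b → Γ.dist (c j) (c (j + 1)) ≤ K) {x : V}
    (hx : Γ.Between (c a) x (c b)) :
    ∃ j, a ≤ j ∧ j ≤ b ∧ Γ.dist x (c j) ≤ δ * k + K := by
  induction k generalizing a b x with
  | zero =>
    refine ⟨a, le_rfl, hab, ?_⟩
    have h : Γ.dist (c a) (c b) ≤ K := by
      rcases Nat.eq_or_lt_of_le hab with rfl | h
      · simp
      · obtain rfl : b = a + 1 := by simp at hk; omega
        exact hc a le_rfl h
    rw [Γ.dist_comm]
    unfold Between at hx
    omega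
  | succ k ih =>
    have h2 : 2 ^ (k + 1) = 2 ^ k + 2 ^ k := by ring
    have hδk : δ * (k + 1) = δ * k + δ := by ring
    -- Bisect the chain: each halving costs one `δ`.
    obtain ⟨w, hw, hxw⟩ := hδ.exists_between hΓ hx (c (a + (b - a) / 2))
    rcases hw with hw | hw
    · obtain ⟨j, hj₁, hj₂, hj⟩ := ih (by omega) (by omega)
        (fun j h₁ h₂ => hc j h₁ (by omega)) hw
      refine ⟨j, hj₁, by omega, ?_⟩
      have := hΓ.dist_triangle (u := x) (v := w) (w := c j)
      omega
    · obtain ⟨j, hj₁, hj₂, hj⟩ := ih (by omega) (by omega)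
        (fun j h₁ h₂ => hc j (by omega) h₂) hw
      refine ⟨j, by omega, hj₂, ?_⟩
      have := hΓ.dist_triangle (u := x) (v := w) (w := c j)
      omega

end SimpleGraph

/-! ### Exponential against linear growth -/

theorem Nat.exists_forall_add_mul_lt_two_pow (A B : ℕ) :
    ∃ k₀, ∀ k ≥ k₀, A + B * k < 2 ^ k := by
  have hr : A + 2 * B + 1 < 2 ^ (A + 2 * B + 1) := Nat.lt_two_pow_self
  refine ⟨2 * (A + 2 * B + 1), fun k hk => ?_⟩
  suffices h : A + B * k < 2 ^ k ∧ B ≤ 2 ^ k from h.1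
  induction k, hk using Nat.le_induction with
  | base =>
    rw [two_mul, pow_add]
    constructor <;> nlinarith
  | succ k hk ih =>
    have h2 : 2 ^ (k + 1) = 2 ^ k + 2 ^ k := by ring
    rw [mul_add]
    omega

/-- A number bounded by a linear function of its own logarithm is bounded. For the least `k` with `M
* D ≤ 2 ^ k`, large `k` would give `2 ^ k < 2 * M * D ≤ 2 * M * (A + B * k)`. -/
theorem Nat.exists_forall_le_of_log_bound (A B M : ℕ) :
    ∃ D₀, ∀ D, (∀ k, M * D ≤ 2 ^ k → D ≤ A + B * k) → D ≤ D₀ := by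
  obtain ⟨k₀, hk₀⟩ := Nat.exists_forall_add_mul_lt_two_pow (2 * M * A) (2 * M * B)
  refine ⟨A + B * k₀, fun D hD => ?_⟩
  have h₁ := hD (Nat.clog 2 (M * D)) (Nat.le_pow_clog (by norm_num) _)
  rcases Nat.lt_or_ge k₀ (Nat.clog 2 (M * D)) with h | h
  · exfalso
    have h₂ := hk₀ _ h.le
    have h₃ : 2 ^ (Nat.clog 2 (M * D) - 1) < M * D :=
      (Nat.lt_clog_iff_pow_lt (by norm_num)).1 (by omega)
    have h₄ : 2 ^ Nat.clog 2 (M * D) = 2 * 2 ^ (Nat.clog 2 (M * D) - 1) := by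
      rw [← pow_succ']
      congr 1
      omega
    have h₅ := Nat.mul_le_mul_left (2 * M) h₁
    nlinarith
  · exact h₁.trans (by gcongr)

/-! ### Stability of quasi-geodesics -/

namespace SimpleGraph

variable {V : Type*} {Γ : SimpleGraph V}

/-- Geodesics stay uniformly close to quasi-geodesics with the same endpoints. -/
theorem SlimTriangles.exists_geodesic_near_quasigeodesic {δ : ℕ} (hδ : Γ.SlimTriangles δ)
    (hΓ : Γ.Connected) (K : ℕ) :
    ∃ D₀ : ℕ, ∀ (c : ℕ → V) (m : ℕ), (∀ j < m, Γ.dist (c j) (c (j + 1)) ≤ K) →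
      (∀ i j, i ≤ j → j ≤ m → j - i ≤ K * Γ.dist (c i) (c j)) →
      ∀ x, Γ.Between (c 0) x (c m) → ∃ j ≤ m, Γ.dist x (c j) ≤ D₀ := by
  classical
  obtain ⟨D₀, hD₀⟩ := Nat.exists_forall_le_of_log_bound (2 * δ + K) δ (6 * K)
  refine ⟨D₀, fun c m hc hq => ?_⟩
  -- The optimal `D` for this chain is to be bounded by a logarithm of itself; optimality supplies a
  -- point `x` at distance at least `D` from the whole chain.
  have hex : ∃ D, ∀ x, Γ.Between (c 0) x (c m) → ∃ j ≤ m, Γ.dist x (c j) ≤ D := by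
    refine ⟨Γ.dist (c 0) (c m), fun x hx => ⟨m, le_rfl, ?_⟩⟩
    unfold Between at hx
    omega
  have hspec := Nat.find_spec hex
  have hmin := fun i => Nat.find_min (H := hex) (m := i)
  generalize Nat.find hex = D at hspec hmin
  suffices hD : D ≤ D₀ by
    intro x hx
    obtain ⟨j, hj, h⟩ := hspec x hx
    exact ⟨j, hj, h.trans hD⟩
  refine hD₀ D fun k hk => ?_
  rcases Nat.eq_zero_or_pos D with rfl | hpos
  · exact Nat.zero_le _
  have hfar := hmin (D - 1) (by omega)
  push Not at hfar
  obtain ⟨x, hx, hfar⟩ := hfar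
  replace hfar : ∀ j ≤ m, D ≤ Γ.dist x (c j) := fun j hj => by have := hfar j hj; omega
  -- a point of the geodesic at distance at most `2 D` from `x` towards one of the endpoints
  have side : ∀ e e', e ≤ m → Γ.Between (c e) x (c e') →
      (∀ v, Γ.Between (c e) v (c e') → ∃ j ≤ m, Γ.dist v (c j) ≤ D) →
      ∃ y a, a ≤ m ∧ Γ.Between (c e) y x ∧ Γ.dist y x ≤ 2 * D ∧ Γ.dist y (c a) ≤ D ∧
        ∀ u, Γ.Between y u (c a) → D ≤ Γ.dist x u := by
    intro e e' he hxe hnear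
    -- If the endpoint is near, it serves as `y` itself. Otherwise `y` is exactly `2 * D` from `x`,
    -- so a geodesic of length at most `D` from `y` stays at least `D` away from `x`.
    rcases Nat.lt_or_ge (Γ.dist (c e) x) (2 * D) with h | h
    · refine ⟨c e, e, he, between_left _ _, h.le, by simp, fun u hu => ?_⟩
      have : Γ.dist (c e) u = 0 := by
        unfold Between at hu
        rw [Γ.dist_self] at hu
        omega
      rw [hΓ.dist_eq_zero_iff] at this
      exact this ▸ hfar e he
    · obtain ⟨y, hy, hyt⟩ := hΓ.exists_dist_eq (a := c e) (b := x)
        (t := Γ.dist (c e) x - 2 * D) (by omega)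
      have hye : Γ.Between (c e) y (c e') := by
        have h₁ := hΓ.dist_triangle (u := c e) (v := y) (w := c e')
        have h₂ := hΓ.dist_triangle (u := y) (v := x) (w := c e')
        unfold Between at *
        omega
      obtain ⟨a, ha, hya⟩ := hnear y hye
      unfold Between at hy
      refine ⟨y, a, ha, hy, by omega, hya, fun u hu => ?_⟩
      have h₁ := hΓ.dist_triangle (u := x) (v := u) (w := y)
      rw [Γ.dist_comm (u := x) (v := y), Γ.dist_comm (u := u) (v := y)] at h₁
      unfold Between at hu
      omega
  obtain ⟨y, a, ha, hy, hyx, hya, hyu⟩ := side 0 m (Nat.zero_le _) hx hspec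
  obtain ⟨z, b, hb, hz, hzx, hzb, hzu⟩ := side m 0 le_rfl hx.symm fun v hv => hspec v hv.symm
  have c₁ := Γ.dist_comm (u := z) (v := x)
  have hyxz : Γ.Between y x z := by
    have h₁ := hΓ.dist_triangle (u := y) (v := x) (w := z)
    have h₂ := hΓ.dist_triangle (u := c 0) (v := y) (w := c m)
    have h₃ := hΓ.dist_triangle (u := y) (v := z) (w := c m)
    have c₂ := Γ.dist_comm (u := z) (v := c m)
    have c₃ := Γ.dist_comm (u := x) (v := c m)
    unfold Between at *
    omega
  -- In the quadrilateral `y, z, c b, c a`, either `D ≤ 2 * δ` or `x` is `2 * δ`-close to `[c a, c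
  -- b]`. That side has length at most `6 * D`, so it is logarithmically close to the chain.
  obtain ⟨w, hw, hxw⟩ := hδ.exists_between hΓ hyxz (c b)
  rcases hw with hw | hw
  swap
  · have := hzu w hw.symm
    omega
  obtain ⟨v, hv, hwv⟩ := hδ.exists_between hΓ hw (c a)
  have hxv := hΓ.dist_triangle (u := x) (v := w) (w := v)
  rcases hv with hv | hv
  · have := hyu v hv
    omega
  have hab : Γ.dist (c a) (c b) ≤ 6 * D := by
    have h₁ := hΓ.dist_triangle (u := c a) (v := y) (w := c b)
    have h₂ := hΓ.dist_triangle (u := y) (v := x) (w := c b)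
    have h₃ := hΓ.dist_triangle (u := x) (v := z) (w := c b)
    have c₂ := Γ.dist_comm (u := c a) (v := y)
    omega
  have hK : K * Γ.dist (c a) (c b) ≤ 2 ^ k := by
    refine le_trans ?_ hk
    calc K * Γ.dist (c a) (c b) ≤ K * (6 * D) := Nat.mul_le_mul_left _ hab
      _ = 6 * K * D := by ring
  have hj : ∃ j ≤ m, Γ.dist v (c j) ≤ δ * k + K := by
    rcases le_total a b with h | h
    · obtain ⟨j, -, hj, h⟩ := hδ.exists_dist_chain_le hΓ k h ((hq a b h hb).trans hK)
        (fun j _ h => hc j (by omega)) hv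
      exact ⟨j, by omega, h⟩
    · rw [Γ.dist_comm] at hK
      obtain ⟨j, -, hj, h⟩ := hδ.exists_dist_chain_le hΓ k h ((hq b a h ha).trans hK)
        (fun j _ h => hc j (by omega)) hv.symm
      exact ⟨j, by omega, h⟩
  obtain ⟨j, hj, hvj⟩ := hj
  have h₁ := hfar j hj
  have h₂ := hΓ.dist_triangle (u := x) (v := v) (w := c j)
  omega

end SimpleGraph

/-! ### Cayley graphs, word length and quasiconvex subgroups -/

section Cayley

open SimpleGraph

variable {G : Type*} [Group G] {S : Set G}

theorem mulCayley_dist_mul_left (g u v : G) :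
    (mulCayley S).dist (g * u) (g * v) = (mulCayley S).dist u v := by
  -- `S` need not generate, and `dist` is `0` on unreachable pairs, so reachability has to be
  -- transported too.
  have hreach : ∀ (g : G) {u v : G}, (mulCayley S).Reachable u v →
      (mulCayley S).Reachable (g * u) (g * v) ∧
        (mulCayley S).dist (g * u) (g * v) ≤ (mulCayley S).dist u v := by
    intro g u v h
    obtain ⟨p, hp⟩ := h.exists_walk_length_eq_dist
    let f : mulCayley S →g mulCayley S :=
      ⟨fun x => g * x, fun h => mulCayley_adj_mul_iff_right.2 h⟩
    refine ⟨⟨p.map f⟩, ?_⟩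
    rw [← hp, ← Walk.length_map f p]
    exact dist_le _
  by_cases h : (mulCayley S).Reachable u v
  · obtain ⟨h₁, h₂⟩ := hreach g h
    have h₃ := (hreach g⁻¹ h₁).2
    rw [inv_mul_cancel_left, inv_mul_cancel_left] at h₃
    exact le_antisymm h₂ h₃
  · rw [dist_eq_zero_of_not_reachable h, dist_eq_zero_of_not_reachable]
    intro h₁
    have h₂ := (hreach g⁻¹ h₁).1
    rw [inv_mul_cancel_left, inv_mul_cancel_left] at h₂
    exact h h₂

theorem mulCayley_dist_eq_wordLength (u v : G) :
    (mulCayley S).dist u v = wordLength S (u⁻¹ * v) := by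
  rw [wordLength, ← mulCayley_dist_mul_left u⁻¹ u v, inv_mul_cancel]

theorem wordLength_inv (g : G) : wordLength S g⁻¹ = wordLength S g := by
  rw [wordLength, dist_comm, mulCayley_dist_eq_wordLength, inv_inv, mul_one]

namespace IsFiniteGeneratingSet

theorem connected (hS : IsFiniteGeneratingSet S) : (mulCayley S).Connected := by
  have key : ∀ g u : G, (mulCayley S).Reachable u (u * g) := by
    intro g
    have hg : g ∈ Subgroup.closure S := hS.2 ▸ Subgroup.mem_top g
    induction hg using Subgroup.closure_induction with
    | mem s hs =>
      intro u
      by_cases h : u = u * s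
      · rw [← h]
      · exact Adj.reachable ((mulCayley_adj _ _ _).2 ⟨h, Or.inl (by simpa using hs)⟩)
    | one => intro u; rw [mul_one]
    | mul a b _ _ ha hb =>
      intro u
      rw [← mul_assoc]
      exact (ha u).trans (hb _)
    | inv a _ ha =>
      intro u
      simpa using (ha (u * a⁻¹)).symm
  have : Nonempty G := ⟨1⟩
  exact ⟨fun u v => by simpa using key (u⁻¹ * v) u⟩

theorem finite_wordLength_le (hS : IsFiniteGeneratingSet S) (r : ℕ) :
    {g | wordLength S g ≤ r}.Finite := by
  induction r with
  | zero =>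
    refine (Set.finite_singleton (1 : G)).subset fun g hg => ?_
    have h : (mulCayley S).dist 1 g = 0 := Nat.le_zero.1 hg
    exact ((hS.connected.dist_eq_zero_iff).1 h).symm
  | succ r ih =>
    have hfin := ih.union (Set.Finite.mul ih (hS.1.union hS.1.inv))
    refine hfin.subset fun g hg => ?_
    rcases Nat.lt_or_ge (wordLength S g) (r + 1) with h | h
    · exact Or.inl (Nat.lt_succ_iff.1 h)
    right
    have h' : (mulCayley S).dist 1 g = r + 1 := le_antisymm hg h
    obtain ⟨y, hy, hyr⟩ := hS.connected.exists_dist_eq (a := 1) (b := g) (t := r) (by omega)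
    have hadj : (mulCayley S).dist y g = 1 := by
      unfold Between at hy
      omega
    rw [dist_eq_one_iff_adj, mulCayley_adj] at hadj
    refine Set.mem_mul.2 ⟨y, hyr.le, y⁻¹ * g, ?_, by simp⟩
    rcases hadj.2 with h | h
    · exact Or.inl h
    · exact Or.inr (by simpa using h)

theorem exists_dist_le_mul (hS : IsFiniteGeneratingSet S) {T : Set G}
    (hT : IsFiniteGeneratingSet T) :
    ∃ K, ∀ u v, (mulCayley T).dist u v ≤ K * (mulCayley S).dist u v := by
  obtain ⟨K, hK⟩ := (hS.1.image (wordLength T)).bddAbove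
  refine ⟨K, fun u v => ?_⟩
  obtain ⟨p, hp⟩ := hS.connected.exists_walk_length_eq_dist u v
  rw [← hp]
  clear hp
  induction p with
  | nil => simp
  | @cons a b c h p ih =>
    have hab : (mulCayley T).dist a b ≤ K := by
      rcases ((mulCayley_adj _ _ _).1 h).2 with h | h
      · rw [mulCayley_dist_eq_wordLength]
        exact hK ⟨_, h, rfl⟩
      · rw [dist_comm, mulCayley_dist_eq_wordLength]
        exact hK ⟨_, h, rfl⟩
    have := hT.connected.dist_triangle (u := a) (v := b) (w := c)
    rw [Walk.length_cons, mul_add]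
    omega

end IsFiniteGeneratingSet

/-- In a hyperbolic group, quasiconvexity of a subgroup does not depend on the finite generating
set. -/
theorem IsQuasiconvexSubgroup.exists_forall_between {δ : ℕ} (hS : IsFiniteGeneratingSet S)
    (hδ : (mulCayley S).SlimTriangles δ) {H : Subgroup G} (hH : IsQuasiconvexSubgroup H) :
    ∃ σ, ∀ x ∈ H, ∀ y ∈ H, ∀ v, (mulCayley S).Between x v y →
      ∃ w ∈ H, (mulCayley S).dist v w ≤ σ := by
  obtain ⟨-, T, hT, τ, hτ⟩ := hH
  obtain ⟨A, hA⟩ := hT.exists_dist_le_mul hS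
  obtain ⟨B, hB⟩ := hS.exists_dist_le_mul hT
  -- A `T`-geodesic is a quasi-geodesic for `S`, so `S`-geodesics with the same endpoints run near
  -- it, hence near `H`.
  obtain ⟨D, hD⟩ := hδ.exists_geodesic_near_quasigeodesic hS.connected (max A B)
  refine ⟨D + A * τ, fun x hx y hy v hv => ?_⟩
  obtain ⟨p, hp⟩ := hT.connected.exists_walk_length_eq_dist x y
  have hstep : ∀ j < p.length, (mulCayley S).dist (p.getVert j) (p.getVert (j + 1)) ≤
      max A B := by
    intro j hj
    have h₁ := p.dist_getVert_getVert_le (Nat.le_add_right j 1)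
    calc _ ≤ A * (mulCayley T).dist (p.getVert j) (p.getVert (j + 1)) := hA _ _
      _ ≤ A * 1 := Nat.mul_le_mul_left _ (by omega)
      _ ≤ max A B := by simp
  have hquasi : ∀ i j, i ≤ j → j ≤ p.length →
      j - i ≤ max A B * (mulCayley S).dist (p.getVert i) (p.getVert j) := by
    intro i j hij hj
    have h₁ := p.dist_getVert_getVert_le (Nat.zero_le i)
    have h₂ := p.dist_getVert_getVert_le hj
    rw [Walk.getVert_zero] at h₁
    rw [Walk.getVert_length] at h₂
    have h₃ := hT.connected.dist_triangle (u := x) (v := p.getVert i) (w := y)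
    have h₄ := hT.connected.dist_triangle (u := p.getVert i) (v := p.getVert j) (w := y)
    calc j - i ≤ (mulCayley T).dist (p.getVert i) (p.getVert j) := by omega
      _ ≤ B * (mulCayley S).dist (p.getVert i) (p.getVert j) := hB _ _
      _ ≤ max A B * (mulCayley S).dist (p.getVert i) (p.getVert j) :=
        Nat.mul_le_mul_right _ (le_max_right _ _)
  obtain ⟨j, hj, hvj⟩ := hD p.getVert p.length hstep hquasi v (by simpa using hv)
  obtain ⟨w, hw, hjw⟩ := hτ x y p hx hy hp _ (p.getVert_mem_support j)
  refine ⟨w, hw, ?_⟩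
  have h₁ := hS.connected.dist_triangle (u := v) (v := p.getVert j) (w := w)
  have h₂ := hA (p.getVert j) w
  have h₃ := Nat.mul_le_mul_left A hjw
  omega

/-- Elements of two quasiconvex subgroups with a large Gromov product can be shortened
simultaneously by an element of the intersection. -/
theorem exists_mem_inf_wordLength_lt {δ : ℕ} (hS : IsFiniteGeneratingSet S)
    (hδ : (mulCayley S).SlimTriangles δ) (σ : ℕ) :
    ∃ C, ∀ H K : Subgroup G,
      (∀ x ∈ H, ∀ y ∈ H, ∀ v, (mulCayley S).Between x v y →
        ∃ w ∈ H, (mulCayley S).dist v w ≤ σ) →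
      (∀ x ∈ K, ∀ y ∈ K, ∀ v, (mulCayley S).Between x v y →
        ∃ w ∈ K, (mulCayley S).dist v w ≤ σ) →
      ∀ p ∈ H, ∀ q ∈ K,
        (mulCayley S).dist p q + 2 * C < wordLength S p + wordLength S q →
        ∃ s ∈ H ⊓ K, wordLength S (s * p) < wordLength S p ∧
          wordLength S (s * q) < wordLength S q := by
  have hΓ := hS.connected
  set F := (hS.finite_wordLength_le (2 * σ + δ)).toFinset with hF
  -- The spacing of the sample points exceeds the total error `2 * σ + 2 * δ` made in the final
  -- shortening.
  set M := 2 * δ + 2 * σ + 1 with hM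
  refine ⟨F.card * M + δ, fun H K hH hK p hp q hq hpq => ?_⟩
  have hpoints : ∀ j ≤ F.card, ∃ a ∈ H, ∃ b ∈ K, a⁻¹ * b ∈ F ∧
      wordLength S a ≤ j * M + σ ∧ (mulCayley S).dist a p + j * M ≤ wordLength S p + σ ∧
      wordLength S b ≤ j * M + σ + δ ∧
      (mulCayley S).dist b q + j * M ≤ wordLength S q + σ + δ := by
    intro j hj
    have hjM : j * M ≤ F.card * M := Nat.mul_le_mul_right _ hj
    have h₁ := hΓ.dist_triangle (u := 1) (v := p) (w := q)
    obtain ⟨x, hx, hxt⟩ := hΓ.exists_dist_eq (a := 1) (b := p) (t := j * M)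
      (by unfold wordLength at hpq; omega)
    obtain ⟨a, ha, hxa⟩ := hH 1 H.one_mem p hp x hx
    obtain ⟨w, hw, hxw⟩ := hδ.exists_between hΓ hx q
    have h₂ := hΓ.dist_triangle (u := 1) (v := x) (w := w)
    have h₃ := hΓ.dist_triangle (u := x) (v := w) (w := p)
    rcases hw with hw | hw
    swap
    -- If `w` lay on `[q, p]`, then passing through `w`, with `|w| ≤ j * M + δ`, would bound the
    -- Gromov product of `p` and `q` by `F.card * M + δ`.
    · exfalso
      have h₄ := hΓ.dist_triangle (u := 1) (v := w) (w := q)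
      have c₁ := dist_comm (G := mulCayley S) (u := q) (v := w)
      have c₂ := dist_comm (G := mulCayley S) (u := q) (v := p)
      unfold wordLength at hpq
      unfold Between at *
      omega
    obtain ⟨b, hb, hwb⟩ := hK 1 K.one_mem q hq w hw
    have c₁ := dist_comm (G := mulCayley S) (u := x) (v := a)
    have c₂ := dist_comm (G := mulCayley S) (u := w) (v := b)
    have c₃ := dist_comm (G := mulCayley S) (u := x) (v := w)
    refine ⟨a, ha, b, hb, ?_, ?_, ?_, ?_, ?_⟩
    · rw [hF, Set.Finite.mem_toFinset, Set.mem_ofPred_eq, ← mulCayley_dist_eq_wordLength]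
      have h₄ := hΓ.dist_triangle (u := a) (v := x) (w := b)
      have h₅ := hΓ.dist_triangle (u := x) (v := w) (w := b)
      omega
    · have := hΓ.dist_triangle (u := 1) (v := x) (w := a)
      unfold wordLength
      omega
    · have := hΓ.dist_triangle (u := a) (v := x) (w := p)
      unfold wordLength
      unfold Between at *
      omega
    · have := hΓ.dist_triangle (u := 1) (v := w) (w := b)
      unfold wordLength
      omega
    · have h₄ := hΓ.dist_triangle (u := b) (v := w) (w := q)
      have h₅ := hΓ.dist_triangle (u := 1) (v := w) (w := x)
      unfold wordLength
      unfold Between at *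
      omega
  choose! a ha b hb hab ha₁ ha₂ hb₁ hb₂ using hpoints
  -- There are `F.card + 1` samples for `F.card` differences. A coincidence gives the element `a i *
  -- (a j)⁻¹ = b i * (b j)⁻¹` of `H ⊓ K`, which cuts out the stretch between the two samples.
  obtain ⟨i, j, hij, hj, heq⟩ : ∃ i j, i < j ∧ j ≤ F.card ∧ (a i)⁻¹ * b i = (a j)⁻¹ * b j := by
    obtain ⟨i, hi, j, hj, hne, heq⟩ := Finset.exists_ne_map_eq_of_card_lt_of_maps_to
      (s := Finset.range (F.card + 1)) (t := F) (f := fun i => (a i)⁻¹ * b i) (by simp)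
      (fun i hi => hab i (by simpa [Nat.lt_succ_iff] using hi))
    rw [Finset.mem_range, Nat.lt_succ_iff] at hi hj
    rcases Nat.lt_or_gt_of_ne hne with h | h
    · exact ⟨i, j, h, hj, heq⟩
    · exact ⟨j, i, h, hi, heq.symm⟩
  have hi : i ≤ F.card := by omega
  have hs : a i * (a j)⁻¹ = b i * (b j)⁻¹ := by
    have h : b i = a i * ((a j)⁻¹ * b j) := by rw [← heq, mul_inv_cancel_left]
    rw [h]
    group
  have hijM : i * M + M ≤ j * M := by
    calc i * M + M = (i + 1) * M := by ring
      _ ≤ j * M := Nat.mul_le_mul_right _ hij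
  have shorten : ∀ u v r : G, wordLength S (u * v⁻¹ * r) ≤
      wordLength S u + (mulCayley S).dist v r := by
    intro u v r
    have h := hΓ.dist_triangle (u := 1) (v := u) (w := u * v⁻¹ * r)
    have h' := mulCayley_dist_mul_left (S := S) (u * v⁻¹) v r
    rw [inv_mul_cancel_right] at h'
    rw [h'] at h
    exact h
  refine ⟨a i * (a j)⁻¹, ⟨H.mul_mem (ha i hi) (H.inv_mem (ha j hj)), ?_⟩, ?_, ?_⟩
  · rw [hs]
    exact K.mul_mem (hb i hi) (K.inv_mem (hb j hj))
  · have h₁ := shorten (a i) (a j) p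
    have h₂ := ha₁ i hi
    have h₃ := ha₂ j hj
    omega
  · rw [hs]
    have h₁ := shorten (b i) (b j) q
    have h₂ := hb₁ i hi
    have h₃ := hb₂ j hj
    omega

end Cayley

/-! ### Product representatives and their minimisation -/

section ProductReps

variable {G : Type*} [Group G] {n : ℕ} {H : Fin n → Subgroup G} {g : G} {h k l : Fin n → G}

theorem ProductRepEquiv.refl (H : Fin n → Subgroup G) (h : Fin n → G) :
    ProductRepEquiv H h h :=
  ⟨1, rfl, rfl, fun _ _ => one_mem _, fun i => by simp⟩

theorem ProductRepEquiv.trans (h₁ : ProductRepEquiv H h k) (h₂ : ProductRepEquiv H k l) :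
    ProductRepEquiv H h l := by
  obtain ⟨s, hs₀, hs₁, hs, hsk⟩ := h₁
  obtain ⟨t, ht₀, ht₁, ht, htl⟩ := h₂
  refine ⟨s * t, by simp [hs₀, ht₀], by simp [hs₁, ht₁],
    fun i hi => mul_mem (hs i hi) (ht i hi), fun i => ?_⟩
  rw [Pi.mul_apply, Pi.mul_apply, mul_assoc, htl, ← mul_assoc, hsk, mul_assoc]

theorem IsProductRep.of_equiv (hh : IsProductRep H g h) (hk : ProductRepEquiv H h k) :
    IsProductRep H g k := by
  obtain ⟨s, hs₀, hs₁, hs, hsk⟩ := hk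
  constructor
  · intro i
    have h₀ : s i.castSucc ∈ H i := by
      obtain ⟨i, hi⟩ := i
      rcases i with _ | i
      · exact hs₀ ▸ one_mem _
      · exact (hs i hi).2
    have h₁ : s i.succ ∈ H i := by
      obtain ⟨i, hi⟩ := i
      rcases Nat.lt_or_ge (i + 1) n with h | h
      · exact (hs i h).1
      · obtain rfl : n = i + 1 := by omega
        exact hs₁ ▸ one_mem _
    rw [← (H i).mul_mem_cancel_left h₀, hsk]
    exact mul_mem (hh.1 i) h₁
  -- The product telescopes, and `s` is trivial at the last index.
  · have key : ∀ j, Fin.partialProd k j = Fin.partialProd h j * s j := by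
      intro j
      induction j using Fin.induction with
      | zero => simp [hs₀]
      | succ i ih =>
        rw [Fin.partialProd_succ, Fin.partialProd_succ, ih, mul_assoc, hsk, mul_assoc]
    have h₁ := key (Fin.last n)
    rw [hs₁, mul_one] at h₁
    rw [← hh.2]
    simpa [Fin.partialProd, List.take_of_length_le] using h₁

/-- Moving an element of `Hᵢ ∩ Hᵢ₊₁` from one factor of a product representative to the next. -/
theorem exists_productRepEquiv_transfer (H : Fin n → Subgroup G) (k : Fin n → G) {i : ℕ}
    (hi : i + 1 < n) {s : G} (hs : s ∈ H ⟨i, by omega⟩ ⊓ H ⟨i + 1, hi⟩) :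
    ∃ k', ProductRepEquiv H k k' ∧ k' ⟨i, by omega⟩ = k ⟨i, by omega⟩ * s⁻¹ ∧
      k' ⟨i + 1, hi⟩ = s * k ⟨i + 1, hi⟩ ∧
      ∀ j : Fin n, (j : ℕ) ≠ i → (j : ℕ) ≠ i + 1 → k' j = k j := by
  let t : Fin (n + 1) → G := fun j => if (j : ℕ) = i + 1 then s⁻¹ else 1
  refine ⟨fun j => (t j.castSucc)⁻¹ * k j * t j.succ,
    ⟨t, by simp [t], ?_, fun j hj => ?_, fun j => by simp [mul_assoc]⟩, ?_, ?_, ?_⟩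
  · simp only [t, Fin.val_last]
    rw [if_neg (by omega)]
  · simp only [t]
    split_ifs with h
    · obtain rfl : j = i := by omega
      exact inv_mem hs
    · exact one_mem _
  · simp [t]
  · simp [t]
  · intro j h₁ h₂
    simp [t, h₁, h₂]

open SimpleGraph in
/-- Each product representative is equivalent to one with a factor of length bounded linearly in
terms of the product. -/
theorem exists_productRepEquiv_wordLength_le {S : Set G} {δ : ℕ} (hS : IsFiniteGeneratingSet S)
    (hδ : (mulCayley S).SlimTriangles δ) (hn : 0 < n) (H : Fin n → Subgroup G)
    (hH : ∀ i, IsQuasiconvexSubgroup (H i)) :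
    ∃ L, ∀ (g : G) (h : Fin n → G), IsProductRep H g h →
      ∃ k, IsProductRep H g k ∧ ProductRepEquiv H h k ∧
        ∃ i, wordLength S (k i) ≤ wordLength S g + L := by
  choose σ hσ using fun i => (hH i).exists_forall_between hS hδ
  have hσ' : ∀ i, ∀ x ∈ H i, ∀ y ∈ H i, ∀ v, (mulCayley S).Between x v y →
      ∃ w ∈ H i, (mulCayley S).dist v w ≤ Finset.univ.sup σ := by
    intro i x hx y hy v hv
    obtain ⟨w, hw, h⟩ := hσ i x hx y hy v hv
    exact ⟨w, hw, h.trans (Finset.le_sup (Finset.mem_univ i))⟩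
  obtain ⟨C, hC⟩ := exists_mem_inf_wordLength_lt hS hδ (Finset.univ.sup σ)
  refine ⟨2 * C + (4 * δ + 2), fun g h hh => ?_⟩
  obtain ⟨k, hhk, hmin⟩ := (measure fun k : Fin n → G => ∑ i, wordLength S (k i)).wf.has_min
    {k | ProductRepEquiv H h k} ⟨h, ProductRepEquiv.refl H h⟩
  have hk := hh.of_equiv hhk
  refine ⟨k, hk, hhk, ?_⟩
  by_contra! hlong
  let x : ℕ → G := fun j => ((List.ofFn k).take j).prod
  have hx : ∀ j (hj : j < n), x (j + 1) = x j * k ⟨j, hj⟩ := fun j hj =>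
    Fin.partialProd_succ k ⟨j, hj⟩
  have hside : ∀ j (hj : j < n), (mulCayley S).dist (x j) (x (j + 1)) =
      wordLength S (k ⟨j, hj⟩) := by
    intro j hj
    rw [hx j hj, mulCayley_dist_eq_wordLength, inv_mul_cancel_left]
  have hbroken := hδ.dist_le_of_broken_line hS.connected (C := C) (x := x) hn ?_ ?_
  · have h₀ := hside 0 hn
    have h₁ := hlong ⟨0, hn⟩
    have h₂ : (mulCayley S).dist (x 0) (x n) = wordLength S g := by
      have : x n = g := by
        rw [← hk.2]
        simp [x, List.take_of_length_le]
      rw [this]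
      simp [x, wordLength]
    rw [zero_add] at h₀
    omega
  · intro i hi
    have := hlong ⟨i, hi⟩
    rw [hside i hi]
    omega
  · intro i hi
    by_contra! hlt
    rw [hside i (by omega), hside (i + 1) hi, hx (i + 1) hi, hx i (by omega)] at hlt
    -- Translating the corner to `1` turns its neighbours into `kᵢ⁻¹ ∈ Hᵢ` and `kᵢ₊₁ ∈ Hᵢ₊₁`.
    have hd : (mulCayley S).dist (x i) (x i * k ⟨i, by omega⟩ * k ⟨i + 1, hi⟩) =
        (mulCayley S).dist (k ⟨i, by omega⟩)⁻¹ (k ⟨i + 1, hi⟩) := by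
      rw [mulCayley_dist_eq_wordLength, mulCayley_dist_eq_wordLength]
      congr 1
      group
    rw [hd, ← wordLength_inv (k ⟨i, by omega⟩)] at hlt
    obtain ⟨s, hs, hs₁, hs₂⟩ := hC _ _ (hσ' ⟨i, by omega⟩) (hσ' ⟨i + 1, hi⟩) _
      (inv_mem (hk.1 ⟨i, by omega⟩)) _ (hk.1 ⟨i + 1, hi⟩) hlt
    obtain ⟨k', hkk', h₁, h₂, h₃⟩ := exists_productRepEquiv_transfer H k hi hs
    have hs₁' : wordLength S (k' ⟨i, by omega⟩) < wordLength S (k ⟨i, by omega⟩) := by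
      rw [h₁, ← wordLength_inv, ← wordLength_inv (k ⟨i, by omega⟩)]
      simpa using hs₁
    have hs₂' : wordLength S (k' ⟨i + 1, hi⟩) < wordLength S (k ⟨i + 1, hi⟩) := by
      rwa [h₂]
    refine hmin k' (hhk.trans hkk') ?_
    change ∑ i, wordLength S (k' i) < ∑ i, wordLength S (k i)
    refine Finset.sum_lt_sum (fun j _ => ?_) ⟨(⟨i, by omega⟩ : Fin n), Finset.mem_univ _, hs₁'⟩
    by_cases hj₁ : (j : ℕ) = i
    · rw [show j = ⟨i, by omega⟩ from Fin.ext hj₁]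
      exact hs₁'.le
    by_cases hj₂ : (j : ℕ) = i + 1
    · rw [show j = ⟨i + 1, hi⟩ from Fin.ext hj₂]
      exact hs₂'.le
    · rw [h₃ j hj₁ hj₂]

end ProductReps

theorem proposition4p2 {Q : Type*} [Group Q] (hQ : IsHyperbolicGroup Q) :
    HasBottleneckedProductReps {H : Subgroup Q | IsQuasiconvexSubgroup H} ∧
    ∀ S : Set Q, IsFiniteGeneratingSet S →
      ∀ (n : ℕ), 0 < n → ∀ H : Fin n → Subgroup Q, (∀ i, IsQuasiconvexSubgroup (H i)) →
        ∃ f : ℕ → ℕ, ∀ (g : Q) (h : Fin n → Q), IsProductRep H g h →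
          ∃ k : Fin n → Q, IsProductRep H g k ∧ ProductRepEquiv H h k ∧
            ∃ i, wordLength S (k i) ≤ f (wordLength S g) := by
  obtain ⟨T, hT, δ, hδ⟩ := hQ
  constructor
  · intro n hn H hH g
    obtain ⟨L, hL⟩ := exists_productRepEquiv_wordLength_le hT hδ hn H hH
    refine ⟨fun i => {k | IsProductRep H g k ∧ wordLength T (k i) ≤ wordLength T g + L},
      fun i k hk => hk.1, fun i => ?_, fun h hh => ?_⟩
    · refine (hT.finite_wordLength_le (wordLength T g + L)).subset ?_
      rintro _ ⟨k, hk, rfl⟩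
      exact hk.2
    · obtain ⟨k, hk, hhk, i, hi⟩ := hL g h hh
      exact ⟨i, k, ⟨hk, hi⟩, hhk⟩
  · intro S hS n hn H hH
    obtain ⟨L, hL⟩ := exists_productRepEquiv_wordLength_le hT hδ hn H hH
    obtain ⟨A, hA⟩ := hT.exists_dist_le_mul hS
    obtain ⟨B, hB⟩ := hS.exists_dist_le_mul hT
    -- The bound `m + L` holds for `T`; `B` converts `|g|` from `S` to `T`, and `A` converts the
    -- factor back.
    refine ⟨fun m => A * (B * m + L), fun g h hh => ?_⟩
    obtain ⟨k, hk, hhk, i, hi⟩ := hL g h hh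
    refine ⟨k, hk, hhk, i, (hA 1 (k i)).trans (Nat.mul_le_mul_left _ (hi.trans ?_))⟩
    exact Nat.add_le_add_right (hB 1 g) L
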